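/- Theorem 2.1. Let $d\ge 1$ and $n\ge 1$ be integers, let $\alpha>0$, let $\Omega\subset\mathbb{R}^d$ be a nonempty bounded open set, and let $f\in L^2(\Omega)$ with $f\ge 0$ almost everywhere in $\Omega$. Put $r=\alpha n^{-1/d}$, let $\Omega_r=\{x\in\mathbb{R}^d : \operatorname{dist}(x,\Omega)<r\}$, and let $$\mathcal{A}(\alpha,n)(\Omega)=\Big\{\overline{\Omega}\cap\bigcup_{i=1}^n\overline{B(x_i,r)} \;:\; x_1,\dots,x_n\in\Omega_r\Big\}.$$ For every $\Sigma\in\mathcal{A}(\alpha,n)(\Omega)$ there is exactly one function $u=u_{f,\Sigma,\Omega}\in H^1_0(\Omega\setminus\Sigma)$, extended by zero outside $\Omega\setminus\Sigma$, such that $$\int_\Omega\nabla u\cdot\nabla\varphi\,dx=\int_\Omega f\varphi\,dx\qquad\text{for all }\varphi\in H^1_0(\Omega\setminus\Sigma),$$ and, with the compliance defined by $F(\Sigma,f,\Omega)=\int_\Omega f\,u_{f,\Sigma,\Omega}\,dx$, the problem $$\min\{F(\Sigma,f,\Omega) : \Sigma\in\mathcal{A}(\alpha,n)(\Omega)\}$$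 admits a solution, that is, there is $\Sigma^*\in\mathcal{A}(\alpha,n)(\Omega)$ with $F(\Sigma^*,f,\Omega)\le F(\Sigma,f,\Omega)$ for all $\Sigma\in\mathcal{A}(\alpha,n)(\Omega)$. -/

import Mathlib

open MeasureTheory Set
open scoped ContDiff RealInnerProductSpace

noncomputable section

/-- The Hilbert space `L²(ℝᵈ) × L²(ℝᵈ; ℝᵈ)`, with the norm `(‖u‖² + ‖g‖²)^(1/2)`. A Sobolev function
`u ∈ H¹(ℝᵈ)` is represented in it by the pair `(u, ∇u)`, whose norm is the `H¹` norm of `u`. -/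
abbrev L2Pair (d : ℕ) : Type :=
  WithLp 2 (Lp ℝ 2 (volume : Measure (EuclideanSpace ℝ (Fin d))) ×
    Lp (EuclideanSpace ℝ (Fin d)) 2 (volume : Measure (EuclideanSpace ℝ (Fin d))))

/-- `φ ∈ C_c^∞(U)`, extended by zero to the whole of `ℝᵈ`. -/
structure IsTestFunction {d : ℕ} (U : Set (EuclideanSpace ℝ (Fin d)))
    (φ : EuclideanSpace ℝ (Fin d) → ℝ) : Prop where
  contDiff : ContDiff ℝ ∞ φ
  hasCompactSupport : HasCompactSupport φ
  tsupport_subset : tsupport φ ⊆ U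

/-- The pairs `(φ, ∇φ)` with `φ ∈ C_c^∞(U)`. -/
def testPairs {d : ℕ} (U : Set (EuclideanSpace ℝ (Fin d))) : Submodule ℝ (L2Pair d) where
  carrier := {p | ∃ φ : EuclideanSpace ℝ (Fin d) → ℝ, IsTestFunction U φ ∧
    p.fst =ᵐ[volume] φ ∧ p.snd =ᵐ[volume] gradient φ}
  zero_mem' := by
    refine ⟨0, ⟨contDiff_const, HasCompactSupport.zero, by simp⟩, Lp.coeFn_zero _ _ _, ?_⟩
    have h : gradient (0 : EuclideanSpace ℝ (Fin d) → ℝ) = 0 := by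
      ext1 x; exact gradient_fun_const x 0
    rw [h]
    exact Lp.coeFn_zero _ _ _
  add_mem' := by
    rintro p q ⟨φ, hφ, hp1, hp2⟩ ⟨ψ, hψ, hq1, hq2⟩
    refine ⟨φ + ψ, ⟨hφ.1.add hψ.1, hφ.2.add hψ.2,
      (tsupport_add φ ψ).trans (union_subset hφ.3 hψ.3)⟩, ?_, ?_⟩
    · filter_upwards [Lp.coeFn_add p.fst q.fst, hp1, hq1] with x h h1 h2
      simp only [WithLp.add_fst, Pi.add_apply] at h ⊢
      rw [h, h1, h2]
    · filter_upwards [Lp.coeFn_add p.snd q.snd, hp2, hq2] with x h h1 h2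
      have d1 : DifferentiableAt ℝ φ x := hφ.1.differentiable (by simp) x
      have d2 : DifferentiableAt ℝ ψ x := hψ.1.differentiable (by simp) x
      simp only [WithLp.add_snd, Pi.add_apply] at h ⊢
      rw [h, h1, h2]
      simp only [gradient]
      rw [fderiv_add d1 d2, map_add]
  smul_mem' := by
    rintro c p ⟨φ, hφ, hp1, hp2⟩
    refine ⟨c • φ, ⟨hφ.1.const_smul c, hφ.2.smul_left (f := fun _ => c),
      (tsupport_smul_subset_right (fun _ => c) φ).trans hφ.3⟩, ?_, ?_⟩
    · filter_upwards [Lp.coeFn_smul c p.fst, hp1] with x h h1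
      simp only [WithLp.smul_fst, Pi.smul_apply] at h ⊢
      rw [h, h1]
    · filter_upwards [Lp.coeFn_smul c p.snd, hp2] with x h h1
      have d1 : DifferentiableAt ℝ φ x := hφ.1.differentiable (by simp) x
      simp only [WithLp.smul_snd, Pi.smul_apply] at h ⊢
      rw [h, h1]
      simp only [gradient]
      rw [fderiv_const_smul d1, map_smul]

/-- The Sobolev space `H¹₀(U)`, the closure of `C_c^∞(U)` in the `H¹` norm. Its elements `u` are
extended by zero outside `U` and stored together with their weak gradient as the pair `(u, ∇u)`. -/
def H10 {d : ℕ} (U : Set (EuclideanSpace ℝ (Fin d))) : Submodule ℝ (L2Pair d) :=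
  (testPairs U).topologicalClosure

/-- `u` is the weak solution of `-Δu = f` in `Ω \ S`, `u = 0` on `S ∪ ∂Ω`: it lies in
`H¹₀(Ω \ S)`, and `∫_Ω ∇u · ∇φ = ∫_Ω f φ` for every `φ ∈ H¹₀(Ω \ S)`.
(`u.fst` is the function and `u.snd` its gradient.) -/
def IsWeakSolution {d : ℕ} (S : Set (EuclideanSpace ℝ (Fin d)))
    (f : EuclideanSpace ℝ (Fin d) → ℝ) (Ω : Set (EuclideanSpace ℝ (Fin d)))
    (u : L2Pair d) : Prop :=
  u ∈ H10 (Ω \ S) ∧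
    ∀ φ ∈ H10 (Ω \ S), ∫ x in Ω, ⟪u.snd x, φ.snd x⟫ = ∫ x in Ω, f x * φ.fst x

/-- The solution `u_{f,S,Ω}`; it is meaningful when the weak solution exists and is unique. -/
def solution {d : ℕ} (S : Set (EuclideanSpace ℝ (Fin d)))
    (f : EuclideanSpace ℝ (Fin d) → ℝ) (Ω : Set (EuclideanSpace ℝ (Fin d))) : L2Pair d :=
  Classical.epsilon (IsWeakSolution S f Ω)

/-- The compliance `F(S, f, Ω) = ∫_Ω f u_{f,S,Ω}`. -/
def compliance {d : ℕ} (S : Set (EuclideanSpace ℝ (Fin d)))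
    (f : EuclideanSpace ℝ (Fin d) → ℝ) (Ω : Set (EuclideanSpace ℝ (Fin d))) : ℝ :=
  ∫ x in Ω, f x * (solution S f Ω).fst x

/-- The class of the sets `closure Ω ∩ ⋃ i, closedBall (x i) r` with `r = α n^(-1/d)` and
centres `x 1, …, x n` in the open `r`-neighbourhood of `Ω`. -/
def admissible {d : ℕ} (α : ℝ) (n : ℕ) (Ω : Set (EuclideanSpace ℝ (Fin d))) :
    Set (Set (EuclideanSpace ℝ (Fin d))) :=
  {S | ∃ x : Fin n → EuclideanSpace ℝ (Fin d),
    (∀ i, x i ∈ Metric.thickening (α * (n : ℝ) ^ (-(1 : ℝ) / (d : ℝ))) Ω) ∧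
    S = closure Ω ∩ ⋃ i, Metric.closedBall (x i) (α * (n : ℝ) ^ (-(1 : ℝ) / (d : ℝ)))}

end

/-! The weak problem is coercive on `H¹₀(Ω \ S)` by Poincaré's inequality, so Lax–Milgram solves it,
and the compliance of `S` is the maximum over `H¹₀(Ω \ S)` of the energy `v ↦ 2 ∫ f v - ∫ |∇v|²`. By
density, the maximum may be replaced by a supremum over test functions, whose compact supports stay
disjoint from the balls when the centres move slightly. Hence the compliance is lower semicontinuous
in the centres, and it attains its minimum on the compact set of centres in the closed neighbourhood
of `Ω`. A ball that meets the open set `Ω` has its centre in the open neighbourhood already, so a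
centre of the minimizer that lies outside it can be moved into it without increasing the
compliance. -/

open Filter Metric Topology

section DirectionalPoincare

theorem neg_mul_le_half_sq_add {a b c R : ℝ} (ha : |a| ≤ R) :
    -(a * (2 * b * c)) ≤ b ^ 2 / 2 + 2 * R ^ 2 * c ^ 2 := by
  have h : a ^ 2 * c ^ 2 ≤ R ^ 2 * c ^ 2 :=
    mul_le_mul_of_nonneg_right (sq_le_sq' (abs_le.1 ha).1 (abs_le.1 ha).2) (sq_nonneg c)
  linarith [sq_nonneg (b + 2 * (a * c))]

variable {E : Type*} [NormedAddCommGroup E] [NormedSpace ℝ E] [FiniteDimensional ℝ E]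
  [MeasurableSpace E] [BorelSpace E] (μ : Measure E) [μ.IsAddHaarMeasure] {L : E →L[ℝ] ℝ} {e : E}
  {φ : E → ℝ}

theorem integral_sq_eq_neg_integral_mul_fderiv (hLe : L e = 1) (hφ : ContDiff ℝ 1 φ)
    (hc : HasCompactSupport φ) :
    ∫ x, φ x ^ 2 ∂μ = -∫ x, L x * (2 * φ x * fderiv ℝ φ x e) ∂μ := by
  have hdiff : Differentiable ℝ φ := hφ.differentiable one_ne_zero
  have hφ_cont : Continuous φ := hφ.continuous
  have hderiv_sq : ∀ x, fderiv ℝ (fun y => φ y ^ 2) x e = 2 * φ x * fderiv ℝ φ x e := fun x => by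
    rw [((hdiff x).hasFDerivAt.pow 2).fderiv]
    simp
  have hintegrable {g : E → ℝ} (hg : Continuous g) (h0 : ∀ x, φ x = 0 → g x = 0) :
      Integrable g μ :=
    hg.integrable_of_hasCompactSupport (hc.mono fun x => mt (h0 x))
  have hparts := integral_mul_fderiv_eq_neg_fderiv_mul_of_integrable (μ := μ) (f := L)
    (g := fun y => φ y ^ 2) (v := e) (hintegrable (by fun_prop) fun x hx => by simp [hx])
    (by simpa only [hderiv_sq] using hintegrable (by fun_prop) fun x hx => by simp [hx])
    (hintegrable (by fun_prop) fun x hx => by simp [hx]) (fun x _ => L.differentiableAt)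
    (fun x _ => (hdiff x).pow 2)
  simp only [hderiv_sq, L.fderiv, hLe, one_mul] at hparts
  rw [hparts, neg_neg]

theorem integral_sq_le_integral_fderiv_apply_sq (hLe : L e = 1) {R : ℝ} (hφ : ContDiff ℝ 1 φ)
    (hc : HasCompactSupport φ) (hR : ∀ x ∈ tsupport φ, |L x| ≤ R) :
    ∫ x, φ x ^ 2 ∂μ ≤ 4 * R ^ 2 * ∫ x, fderiv ℝ φ x e ^ 2 ∂μ := by
  have hφ_cont : Continuous φ := hφ.continuous
  have hintegrable {g : E → ℝ} (hg : Continuous g) (h0 : ∀ x ∉ tsupport φ, g x = 0) :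
      Integrable g μ :=
    hg.integrable_of_hasCompactSupport (HasCompactSupport.intro hc fun x => h0 x)
  have hφ_zero : ∀ x ∉ tsupport φ, φ x = 0 := fun x => image_eq_zero_of_notMem_tsupport
  have hderiv_zero : ∀ x ∉ tsupport φ, fderiv ℝ φ x = 0 := fun x hx =>
    fderiv_of_notMem_tsupport ℝ hx
  have hint_sq : Integrable (fun x => φ x ^ 2) μ :=
    hintegrable (by fun_prop) fun x hx => by simp [hφ_zero x hx]
  have hint_deriv_sq : Integrable (fun x => fderiv ℝ φ x e ^ 2) μ :=
    hintegrable (by fun_prop) fun x hx => by simp [hderiv_zero x hx]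
  have hint_mul : Integrable (fun x => L x * (2 * φ x * fderiv ℝ φ x e)) μ :=
    hintegrable (by fun_prop) fun x hx => by simp [hφ_zero x hx]
  have hpointwise : ∀ x, -(L x * (2 * φ x * fderiv ℝ φ x e)) ≤
      φ x ^ 2 / 2 + 2 * R ^ 2 * fderiv ℝ φ x e ^ 2 := fun x => by
    by_cases hx : x ∈ tsupport φ
    · exact neg_mul_le_half_sq_add (hR x hx)
    · simp [hφ_zero x hx, hderiv_zero x hx]
  have hhalf : ∫ x, φ x ^ 2 ∂μ ≤
      (∫ x, φ x ^ 2 ∂μ) / 2 + 2 * R ^ 2 * ∫ x, fderiv ℝ φ x e ^ 2 ∂μ :=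
    calc ∫ x, φ x ^ 2 ∂μ = ∫ x, -(L x * (2 * φ x * fderiv ℝ φ x e)) ∂μ := by
          rw [integral_sq_eq_neg_integral_mul_fderiv μ hLe hφ hc, integral_neg]
      _ ≤ ∫ x, φ x ^ 2 / 2 + 2 * R ^ 2 * fderiv ℝ φ x e ^ 2 ∂μ :=
          integral_mono hint_mul.neg ((hint_sq.div_const 2).add (hint_deriv_sq.const_mul _))
            hpointwise
      _ = _ := by
          rw [integral_add (hint_sq.div_const 2) (hint_deriv_sq.const_mul _), integral_div,
            integral_const_mul]
  linarith

end DirectionalPoincare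

section Poincare

theorem norm_sq_eq_integral_norm_sq {X F : Type*} [MeasurableSpace X] {μ : Measure X}
    [NormedAddCommGroup F] [InnerProductSpace ℝ F] (g : Lp F 2 μ) :
    ‖g‖ ^ 2 = ∫ x, ‖g x‖ ^ 2 ∂μ := by
  rw [← real_inner_self_eq_norm_sq, L2.inner_def]
  simp only [real_inner_self_eq_norm_sq]

variable {d : ℕ} {U W : Set (EuclideanSpace ℝ (Fin d))}

theorem IsTestFunction.mono (h : U ⊆ W) {φ : EuclideanSpace ℝ (Fin d) → ℝ}
    (hφ : IsTestFunction U φ) : IsTestFunction W φ :=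
  { hφ with tsupport_subset := hφ.tsupport_subset.trans h }

theorem testPairs_mono (h : U ⊆ W) : testPairs U ≤ testPairs W :=
  fun _ ⟨φ, hφ, hfst, hsnd⟩ => ⟨φ, hφ.mono h, hfst, hsnd⟩

theorem H10_mono (h : U ⊆ W) : H10 U ≤ H10 W :=
  Submodule.topologicalClosure_mono (testPairs_mono h)

theorem norm_fst_sq_le_of_mem_testPairs {i : Fin d} {R : ℝ} (hU : ∀ x ∈ U, |x i| ≤ R)
    {p : L2Pair d} (hp : p ∈ testPairs U) : ‖p.fst‖ ^ 2 ≤ 4 * R ^ 2 * ‖p.snd‖ ^ 2 := by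
  obtain ⟨φ, hφ, hfst, hsnd⟩ := hp
  let e : EuclideanSpace ℝ (Fin d) := EuclideanSpace.single i 1
  have hgrad : ∀ x, |fderiv ℝ φ x e| ≤ ‖gradient φ x‖ := fun x => by
    rw [gradient, LinearIsometryEquiv.norm_map]
    simpa [e] using (fderiv ℝ φ x).le_opNorm e
  have hfst_norm : ‖p.fst‖ ^ 2 = ∫ x, φ x ^ 2 := by
    rw [norm_sq_eq_integral_norm_sq]
    refine integral_congr_ae ?_
    filter_upwards [hfst] with x hx
    rw [hx, Real.norm_eq_abs, sq_abs]
  have hsnd_norm : ∫ x, fderiv ℝ φ x e ^ 2 ≤ ‖p.snd‖ ^ 2 := by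
    rw [norm_sq_eq_integral_norm_sq]
    refine integral_mono_of_nonneg (.of_forall fun x => sq_nonneg _)
      ((memLp_two_iff_integrable_sq_norm (Lp.aestronglyMeasurable _)).1 (Lp.memLp p.snd)) ?_
    filter_upwards [hsnd] with x hx
    rw [hx]
    exact sq_le_sq.2 ((hgrad x).trans (le_abs_self _))
  calc ‖p.fst‖ ^ 2 = ∫ x, φ x ^ 2 := hfst_norm
    _ ≤ 4 * R ^ 2 * ∫ x, fderiv ℝ φ x e ^ 2 :=
        integral_sq_le_integral_fderiv_apply_sq volume (L := EuclideanSpace.proj i) (by simp [e])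
          (hφ.contDiff.of_le (by simp)) hφ.hasCompactSupport fun x hx =>
            hU x (hφ.tsupport_subset hx)
    _ ≤ 4 * R ^ 2 * ‖p.snd‖ ^ 2 := by gcongr

/-- Poincaré's inequality on `H¹₀(U)`, which makes the Dirichlet form coercive there. The constant
compares the squared norms. -/
def HasPoincareInequality (U : Set (EuclideanSpace ℝ (Fin d))) : Prop :=
  ∃ C : ℝ, ∀ p ∈ H10 U, ‖p.fst‖ ^ 2 ≤ C * ‖p.snd‖ ^ 2

theorem HasPoincareInequality.mono (h : U ⊆ W) (hW : HasPoincareInequality W) :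
    HasPoincareInequality U :=
  hW.imp fun _ hC p hp => hC p (H10_mono h hp)

theorem hasPoincareInequality_of_abs_apply_le {i : Fin d} {R : ℝ} (hU : ∀ x ∈ U, |x i| ≤ R) :
    HasPoincareInequality U := by
  refine ⟨4 * R ^ 2, fun p hp => ?_⟩
  have hclosed : IsClosed {p : L2Pair d | ‖p.fst‖ ^ 2 ≤ 4 * R ^ 2 * ‖p.snd‖ ^ 2} :=
    isClosed_le (by fun_prop) (by fun_prop)
  exact closure_minimal (fun _ => norm_fst_sq_le_of_mem_testPairs hU) hclosed hp

theorem hasPoincareInequality_of_isBounded (hd : 1 ≤ d) (hU : Bornology.IsBounded U) :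
    HasPoincareInequality U := by
  obtain ⟨R, hR⟩ := hU.exists_norm_le
  exact hasPoincareInequality_of_abs_apply_le (i := ⟨0, hd⟩) fun x hx =>
    (PiLp.norm_apply_le x _).trans (hR x hx)

end Poincare

section WeakProblem

theorem existsUnique_inner_map_eq {V H : Type*} [NormedAddCommGroup V] [InnerProductSpace ℝ V]
    [CompleteSpace V] [NormedAddCommGroup H] [InnerProductSpace ℝ H] (T : V →L[ℝ] H)
    (ℓ : V →L[ℝ] ℝ) {C : ℝ} (hT : ∀ v, ‖v‖ ^ 2 ≤ C * ‖T v‖ ^ 2) :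
    ∃! u, ∀ v, ⟪T u, T v⟫ = ℓ v := by
  let B : V →L[ℝ] V →L[ℝ] ℝ :=
    (isBoundedBilinearMap_inner (𝕜 := ℝ) (E := H)).toContinuousLinearMap.bilinearComp T T
  have hB : IsCoercive B := by
    refine ⟨(max C 1)⁻¹, by positivity, fun u => ?_⟩
    change (max C 1)⁻¹ * ‖u‖ * ‖u‖ ≤ ⟪T u, T u⟫
    rw [real_inner_self_eq_norm_sq, mul_assoc, ← sq, inv_mul_le_iff₀ (by positivity)]
    exact (hT u).trans (mul_le_mul_of_nonneg_right (le_max_left _ _) (sq_nonneg _))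
  let A := hB.continuousLinearEquivOfBilin
  let w := (InnerProductSpace.toDual ℝ V).symm ℓ
  have hAw : ∀ u, (∀ v, ⟪T u, T v⟫ = ℓ v) ↔ A u = w := fun u => by
    rw [ext_iff_inner_right ℝ]
    refine forall_congr' fun v => ?_
    rw [hB.continuousLinearEquivOfBilin_apply, InnerProductSpace.toDual_symm_apply]
    rfl
  simpa only [hAw] using A.bijective.existsUnique w

variable {d : ℕ} {Ω U S S' : Set (EuclideanSpace ℝ (Fin d))} {f : EuclideanSpace ℝ (Fin d) → ℝ}

theorem snd_ae_eq_zero_of_mem_H10 {p : L2Pair d} (hp : p ∈ H10 U) :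
    ∀ᵐ x, x ∉ U → p.snd x = 0 := by
  let restrictCompl := LpToLpRestrictCLM (EuclideanSpace ℝ (Fin d)) (EuclideanSpace ℝ (Fin d)) ℝ
    volume 2 Uᶜ
  have hclosed : IsClosed {q : L2Pair d | restrictCompl q.snd = 0} :=
    isClosed_eq (by fun_prop) continuous_const
  have htest : (testPairs U : Set (L2Pair d)) ⊆ {q | restrictCompl q.snd = 0} := by
    rintro q ⟨φ, hφ, -, hsnd⟩
    have hcompl : ∀ᵐ x ∂volume.restrict Uᶜ, x ∈ (tsupport φ)ᶜ :=
      ae_mono (Measure.restrict_mono_set _ (compl_subset_compl.2 hφ.tsupport_subset))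
        (ae_restrict_mem (isClosed_tsupport φ).measurableSet.compl)
    refine (Lp.eq_zero_iff_ae_eq_zero).2 ?_
    filter_upwards [LpToLpRestrictCLM_coeFn ℝ Uᶜ q.snd, ae_restrict_of_ae hsnd, hcompl]
      with x hrestrict hx hxφ
    rw [hrestrict, hx, gradient, fderiv_of_notMem_tsupport ℝ hxφ, map_zero, Pi.zero_apply]
  have hzero : restrictCompl p.snd = 0 := closure_minimal htest hclosed hp
  refine ae_imp_of_ae_restrict (s := Uᶜ) ?_
  filter_upwards [LpToLpRestrictCLM_coeFn ℝ Uᶜ p.snd, (Lp.eq_zero_iff_ae_eq_zero).1 hzero]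
    with x hrestrict hx
  rw [← hrestrict, hx, Pi.zero_apply]

theorem setIntegral_inner_snd_eq_inner (hU : U ⊆ Ω) {p : L2Pair d} (hp : p ∈ H10 U)
    (q : L2Pair d) : ∫ x in Ω, ⟪p.snd x, q.snd x⟫ = ⟪p.snd, q.snd⟫ := by
  rw [L2.inner_def]
  refine setIntegral_eq_integral_of_ae_compl_eq_zero ?_
  filter_upwards [snd_ae_eq_zero_of_mem_H10 hp] with x hx hxΩ
  rw [hx (mt (@hU x) hxΩ), inner_zero_left]

/-- The continuous linear functional `v ↦ ∫_Ω f v` on pairs `(v, ∇v)`: the right-hand side of the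
weak problem. -/
noncomputable def loadFunctional (hf : MemLp f 2 (volume.restrict Ω)) : L2Pair d →L[ℝ] ℝ :=
  (innerSL ℝ (hf.toLp f)).comp
    ((LpToLpRestrictCLM (EuclideanSpace ℝ (Fin d)) ℝ ℝ volume 2 Ω).comp (WithLp.fstL 2 ℝ _ _))

theorem loadFunctional_apply (hf : MemLp f 2 (volume.restrict Ω)) (v : L2Pair d) :
    loadFunctional hf v = ∫ x in Ω, f x * v.fst x := by
  change ⟪hf.toLp f, LpToLpRestrictCLM (EuclideanSpace ℝ (Fin d)) ℝ ℝ volume 2 Ω v.fst⟫ = _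
  rw [L2.inner_def]
  refine integral_congr_ae ?_
  filter_upwards [hf.coeFn_toLp, LpToLpRestrictCLM_coeFn ℝ Ω v.fst] with x hfx hvx
  rw [hfx, hvx, real_inner_comm, RCLike.inner_apply, conj_trivial]

theorem isWeakSolution_iff (hf : MemLp f 2 (volume.restrict Ω)) {u : L2Pair d} :
    IsWeakSolution S f Ω u ↔ u ∈ H10 (Ω \ S) ∧
      ∀ φ ∈ H10 (Ω \ S), ⟪u.snd, φ.snd⟫ = loadFunctional hf φ := by
  refine and_congr_right fun hu => forall₂_congr fun φ _ => ?_
  rw [setIntegral_inner_snd_eq_inner sdiff_subset hu, loadFunctional_apply]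

theorem existsUnique_isWeakSolution (hΩ : HasPoincareInequality (Ω \ S))
    (hf : MemLp f 2 (volume.restrict Ω)) : ∃! u : L2Pair d, IsWeakSolution S f Ω u := by
  obtain ⟨C, hC⟩ := hΩ
  have : CompleteSpace (H10 (Ω \ S)) :=
    (Submodule.isClosed_topologicalClosure _).completeSpace_coe
  let T := (WithLp.sndL 2 ℝ (Lp ℝ 2 (volume : Measure (EuclideanSpace ℝ (Fin d))))
    (Lp (EuclideanSpace ℝ (Fin d)) 2 volume)).comp (H10 (Ω \ S)).subtypeL
  have hT : ∀ v, ‖v‖ ^ 2 ≤ (C + 1) * ‖T v‖ ^ 2 := fun v => by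
    rw [Submodule.coe_norm, WithLp.prod_norm_sq_eq_of_L2, add_one_mul]
    exact add_le_add_left (hC v v.2) _
  obtain ⟨u, hu, huniq⟩ :=
    existsUnique_inner_map_eq T ((loadFunctional hf).comp (H10 (Ω \ S)).subtypeL) hT
  refine ⟨u, (isWeakSolution_iff hf).2 ⟨u.2, fun φ hφ => hu ⟨φ, hφ⟩⟩, fun w hw => ?_⟩
  obtain ⟨hw_mem, hw_eq⟩ := (isWeakSolution_iff hf).1 hw
  exact congrArg Subtype.val (huniq ⟨w, hw_mem⟩ fun v => hw_eq v v.2)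

/-- The functional `v ↦ 2 ℓ(v) - ∫ |∇v|²`, whose maximum over `H¹₀(Ω \ S)` is the compliance of `S`
when `ℓ` is the load functional of `f`. -/
noncomputable def energy (ℓ : L2Pair d →L[ℝ] ℝ) (v : L2Pair d) : ℝ :=
  2 * ℓ v - ‖v.snd‖ ^ 2

theorem continuous_energy (ℓ : L2Pair d →L[ℝ] ℝ) : Continuous (energy ℓ) := by
  unfold energy
  fun_prop

theorem IsWeakSolution.isGreatest_energy (hf : MemLp f 2 (volume.restrict Ω)) {u : L2Pair d}
    (hu : IsWeakSolution S f Ω u) :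
    IsGreatest (energy (loadFunctional hf) '' H10 (Ω \ S)) (loadFunctional hf u) := by
  obtain ⟨hu_mem, hu_eq⟩ := (isWeakSolution_iff hf).1 hu
  have hu_norm : ‖u.snd‖ ^ 2 = loadFunctional hf u := by
    rw [← hu_eq u hu_mem, real_inner_self_eq_norm_sq]
  refine ⟨⟨u, hu_mem, by rw [energy, hu_norm]; ring⟩, ?_⟩
  rintro _ ⟨v, hv, rfl⟩
  have hsq : 0 ≤ ‖u.snd‖ ^ 2 - 2 * ⟪u.snd, v.snd⟫ + ‖v.snd‖ ^ 2 := by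
    rw [← norm_sub_sq_real]
    positivity
  rw [hu_norm, hu_eq v hv] at hsq
  rw [energy]
  linarith

theorem isGreatest_energy_compliance (hΩ : HasPoincareInequality (Ω \ S))
    (hf : MemLp f 2 (volume.restrict Ω)) :
    IsGreatest (energy (loadFunctional hf) '' H10 (Ω \ S)) (compliance S f Ω) := by
  rw [compliance, ← loadFunctional_apply hf]
  exact (Classical.epsilon_spec (existsUnique_isWeakSolution hΩ hf).exists).isGreatest_energy hf

theorem compliance_le_of_sdiff_subset (hΩ : HasPoincareInequality (Ω \ S'))
    (hf : MemLp f 2 (volume.restrict Ω)) (h : Ω \ S ⊆ Ω \ S') :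
    compliance S f Ω ≤ compliance S' f Ω :=
  (isGreatest_energy_compliance (hΩ.mono h) hf).mono (isGreatest_energy_compliance hΩ hf)
    (image_mono (H10_mono h))

theorem lowerSemicontinuousAt_compliance {X : Type*} [TopologicalSpace X]
    {S : X → Set (EuclideanSpace ℝ (Fin d))} {x : X} (hΩ : HasPoincareInequality Ω)
    (hf : MemLp f 2 (volume.restrict Ω))
    (hS : ∀ K ⊆ Ω \ S x, IsCompact K → ∀ᶠ y in 𝓝 x, Disjoint K (S y)) :
    LowerSemicontinuousAt (fun y => compliance (S y) f Ω) x := by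
  intro c hc
  have hmax (y : X) := isGreatest_energy_compliance (hΩ.mono (sdiff_subset (t := S y))) hf
  obtain ⟨u, hu, hu_eq⟩ := (hmax x).1
  obtain ⟨v, hcv, φ, hφ, hfst, hsnd⟩ := mem_closure_iff.1 hu _
    (isOpen_lt continuous_const (continuous_energy (loadFunctional hf))) (hc.trans_eq hu_eq.symm)
  filter_upwards [hS _ hφ.tsupport_subset hφ.hasCompactSupport] with y hy
  have hφy : IsTestFunction (Ω \ S y) φ :=
    { hφ with tsupport_subset := subset_sdiff.2 ⟨hφ.tsupport_subset.trans sdiff_subset, hy⟩ }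
  have hv : v ∈ H10 (Ω \ S y) := Submodule.le_topologicalClosure _ ⟨φ, hφy, hfst, hsnd⟩
  exact hcv.trans_le ((hmax y).2 ⟨v, hv, rfl⟩)

end WeakProblem

section Balls

theorem sdiff_closure_inter {X : Type*} [TopologicalSpace X] (s t : Set X) :
    s \ (closure s ∩ t) = s \ t := by
  rw [sdiff_inter, sdiff_eq_empty.2 subset_closure, empty_union]

theorem eventually_disjoint_iUnion_closedBall {X ι : Type*} [PseudoMetricSpace X] [Finite ι]
    {K : Set X} (hK : IsCompact K) {r : ℝ} {x : ι → X}
    (h : Disjoint K (⋃ i, closedBall (x i) r)) :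
    ∀ᶠ y in 𝓝 x, Disjoint K (⋃ i, closedBall (y i) r) := by
  simp only [disjoint_left, mem_iUnion, mem_closedBall, not_exists, not_le] at h ⊢
  refine hK.eventually_forall_of_forall_eventually fun z hz => eventually_all.2 fun i => ?_
  have hdist : Continuous fun q : (ι → X) × X => dist q.2 (q.1 i) := by fun_prop
  exact hdist.continuousAt.eventually (lt_mem_nhds (h hz i))

theorem exists_mem_thickening_inter_closedBall_subset {E : Type*} [SeminormedAddCommGroup E]
    [NormedSpace ℝ E] {Ω : Set E} (hΩo : IsOpen Ω) (hΩn : Ω.Nonempty) {r : ℝ} (hr : 0 < r)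
    (x : E) : ∃ y ∈ thickening r Ω, Ω ∩ closedBall x r ⊆ closedBall y r := by
  rcases (Ω ∩ closedBall x r).eq_empty_or_nonempty with hempty | ⟨z, hzΩ, hzx⟩
  · obtain ⟨y, hy⟩ := hΩn
    exact ⟨y, self_subset_thickening hr Ω hy, by simp [hempty]⟩
  · rw [← closure_ball x hr.ne'] at hzx
    obtain ⟨w, hwΩ, hwx⟩ := mem_closure_iff.1 hzx Ω hΩo hzΩ
    exact ⟨x, mem_thickening_iff.2 ⟨w, hwΩ, mem_ball'.1 hwx⟩, inter_subset_right⟩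

variable {d : ℕ} {ι : Type*} {Ω : Set (EuclideanSpace ℝ (Fin d))}
  {f : EuclideanSpace ℝ (Fin d) → ℝ}

theorem lowerSemicontinuous_compliance_iUnion_closedBall [Finite ι]
    (hΩ : HasPoincareInequality Ω) (hf : MemLp f 2 (volume.restrict Ω)) (r : ℝ) :
    LowerSemicontinuous fun x : ι → EuclideanSpace ℝ (Fin d) =>
      compliance (closure Ω ∩ ⋃ i, closedBall (x i) r) f Ω := by
  refine fun x => lowerSemicontinuousAt_compliance hΩ hf fun K hK hK_compact => ?_
  rw [sdiff_closure_inter, subset_sdiff] at hK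
  exact (eventually_disjoint_iUnion_closedBall hK_compact hK.2).mono fun _ hy =>
    hy.mono_right inter_subset_right

theorem exists_mem_thickening_compliance_le (hΩ : HasPoincareInequality Ω) (hΩo : IsOpen Ω)
    (hΩn : Ω.Nonempty) (hf : MemLp f 2 (volume.restrict Ω)) {r : ℝ} (hr : 0 < r)
    (x : ι → EuclideanSpace ℝ (Fin d)) :
    ∃ y : ι → EuclideanSpace ℝ (Fin d), (∀ i, y i ∈ thickening r Ω) ∧
      compliance (closure Ω ∩ ⋃ i, closedBall (y i) r) f Ω ≤
        compliance (closure Ω ∩ ⋃ i, closedBall (x i) r) f Ω := by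
  choose y hy hxy using fun i => exists_mem_thickening_inter_closedBall_subset hΩo hΩn hr (x i)
  refine ⟨y, hy, compliance_le_of_sdiff_subset (hΩ.mono sdiff_subset) hf ?_⟩
  rw [sdiff_closure_inter, sdiff_closure_inter]
  refine fun z hz => ⟨hz.1, fun hzx => hz.2 ?_⟩
  obtain ⟨i, hi⟩ := mem_iUnion.1 hzx
  exact mem_iUnion.2 ⟨i, hxy i ⟨hz.1, hi⟩⟩

end Balls

theorem theorem2p1_general {d : ℕ} {ι : Type*} [Finite ι] (hd : 1 ≤ d) {r : ℝ} (hr : 0 < r)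
    {Ω : Set (EuclideanSpace ℝ (Fin d))} (hΩo : IsOpen Ω) (hΩb : Bornology.IsBounded Ω)
    (hΩn : Ω.Nonempty) {f : EuclideanSpace ℝ (Fin d) → ℝ}
    (hf : MemLp f 2 (volume.restrict Ω)) :
    (∀ S, ∃! u : L2Pair d, IsWeakSolution S f Ω u) ∧
    ∃ x : ι → EuclideanSpace ℝ (Fin d), (∀ i, x i ∈ thickening r Ω) ∧
      ∀ y : ι → EuclideanSpace ℝ (Fin d),
        compliance (closure Ω ∩ ⋃ i, closedBall (x i) r) f Ω ≤
          compliance (closure Ω ∩ ⋃ i, closedBall (y i) r) f Ω := by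
  have hΩ : HasPoincareInequality Ω := hasPoincareInequality_of_isBounded hd hΩb
  refine ⟨fun S => existsUnique_isWeakSolution (hΩ.mono sdiff_subset) hf, ?_⟩
  have hmove (y : ι → EuclideanSpace ℝ (Fin d)) :=
    exists_mem_thickening_compliance_le hΩ hΩo hΩn hf hr y
  let K : Set (ι → EuclideanSpace ℝ (Fin d)) := univ.pi fun _ => closure (thickening r Ω)
  have hK : IsCompact K := isCompact_univ_pi fun _ => hΩb.thickening.isCompact_closure
  have hK_nonempty : K.Nonempty :=
    univ_pi_nonempty_iff.2 fun _ => (hΩn.mono (self_subset_thickening hr Ω)).closure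
  obtain ⟨x₀, -, hx₀⟩ := ((lowerSemicontinuous_compliance_iUnion_closedBall hΩ hf
    r).lowerSemicontinuousOn K).exists_isMinOn hK_nonempty hK
  obtain ⟨x, hx, hxx₀⟩ := hmove x₀
  refine ⟨x, hx, fun y => ?_⟩
  obtain ⟨z, hz, hzy⟩ := hmove y
  exact hxx₀.trans ((hx₀ fun i _ => subset_closure (hz i)).trans hzy)

theorem theorem2p1 {d n : ℕ} (hd : 1 ≤ d) (hn : 1 ≤ n) {α : ℝ} (hα : 0 < α)
    {Ω : Set (EuclideanSpace ℝ (Fin d))} (hΩo : IsOpen Ω) (hΩb : Bornology.IsBounded Ω)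
    (hΩn : Ω.Nonempty) {f : EuclideanSpace ℝ (Fin d) → ℝ}
    (hf : MemLp f 2 (volume.restrict Ω)) (hf0 : ∀ᵐ x ∂(volume.restrict Ω), 0 ≤ f x) :
    (∀ S ∈ admissible α n Ω, ∃! u : L2Pair d, IsWeakSolution S f Ω u) ∧
    ∃ S ∈ admissible α n Ω, ∀ S' ∈ admissible α n Ω,
      compliance S f Ω ≤ compliance S' f Ω := by
  have hr : 0 < α * (n : ℝ) ^ (-(1 : ℝ) / (d : ℝ)) := by positivity
  obtain ⟨hu, x, hx, hmin⟩ := theorem2p1_general (ι := Fin n) hd hr hΩo hΩb hΩn hf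
  exact ⟨fun S _ => hu S, _, ⟨x, hx, rfl⟩, by rintro _ ⟨y, -, rfl⟩; exact hmin y⟩
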